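/- Let $I\subseteq\mathbb R$ be a nonempty open set (for instance an open interval) and let $\mathbf r:I\to\mathbb R^3$ be a rational helix: the coordinates of $\mathbf r$ are rational functions without poles in $I$, and $\mathbf r'(t)=\sigma(t)\,\mathbf t(t)$ on $I$, where $\sigma$ is a rational function that does not vanish identically, the unit tangent $\mathbf t$ is a rational vector field with $|\mathbf t(t)|=1$ for all $t\in I$, and $\mathbf t$ makes a constant angle with a fixed direction and is not contained in a great circle: $\mathbf t(t)\cdot\mathbf u=\cos\psi$ for all $t\in I$, with a constant unit vector $\mathbf u$ and a constant $\psi\in(0,\pi)$, $\psi\neq\pi/2$. Suppose that $\mathbf t$ has degree $2$, that is, $\mathbf t=(p_1,p_2,p_3)/q$ with real polynomials $p_1,p_2,p_3,q$ without a common factor of positive degree, the largest of whose degrees is $2$. Then $\mathbf r$ admits no rational rotation-minimizing frame on $I$: there are no rational vector fields $\mathbf f_1,\mathbf f_2,\mathbf f_3$, without poles in $I$, such that for all $t\in I$ the vectors $\mathbf f_1(t),\mathbf f_2(t),\mathbf f_3(t)$ form an orthonormal basis of $\mathbb R^3$, $\mathbf f_1$ is a unit tangent of $\mathbf r$ (that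 is, $\mathbf r'=\rho\,\mathbf f_1$ on $I$ for some rational function $\rho$ that does not vanish identically), and $\mathbf f_2'(t)\cdot\mathbf f_3(t)=0$. -/

import Mathlib

/-- Euclidean three-space. -/
abbrev Space3 : Type := EuclideanSpace ℝ (Fin 3)

/-- A scalar function that is given on `I` by a rational function without poles in `I`. -/
def IsRationalOn (I : Set ℝ) (f : ℝ → ℝ) : Prop :=
  ∃ p q : Polynomial ℝ, ∀ t ∈ I, q.eval t ≠ 0 ∧ f t = p.eval t / q.eval t

/-- A vector function all of whose coordinates are rational on `I`. -/
def IsRationalVecOn (I : Set ℝ) (v : ℝ → Space3) : Prop :=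
  ∀ i : Fin 3, IsRationalOn I (fun t => v t i)

/-- `v` is on `I` a rational vector field of degree `d`: it is `(p₀, p₁, p₂) / q` in lowest terms
(the four polynomials have no common factor), and the largest of the four degrees is `d`. -/
def HasRationalDegreeOn (I : Set ℝ) (v : ℝ → Space3) (d : ℕ) : Prop :=
  ∃ (p : Fin 3 → Polynomial ℝ) (q : Polynomial ℝ),
    (∀ g : Polynomial ℝ, g ∣ q → (∀ i, g ∣ p i) → IsUnit g) ∧
    max q.natDegree (Finset.univ.sup fun i => (p i).natDegree) = d ∧
    ∀ t ∈ I, q.eval t ≠ 0 ∧ ∀ i, v t i = (p i).eval t / q.eval t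

/-- `T` is a unit tangent field of the curve `r` on `I`: `|T| = 1` and `r' = σ T`, where the scalar
speed `σ` is a rational function that does not vanish identically. Where `r' ≠ 0` this says
`T = ± r' / |r'|`; isolated cusps (zeros of `σ`) are allowed. -/
def IsUnitTangentOn (I : Set ℝ) (r T : ℝ → Space3) : Prop :=
  (∀ t ∈ I, ‖T t‖ = 1) ∧
  ∃ σ : ℝ → ℝ, IsRationalOn I σ ∧ (∃ t ∈ I, σ t ≠ 0) ∧ ∀ t ∈ I, HasDerivAt r (σ t • T t) t

/-- `r` is on `I` a rational helix with unit tangent `T`: a rational curve with rational unit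
tangent that makes a constant angle `ψ` with a fixed unit vector `u` and so runs in a small circle
of the unit sphere (neither a single point, `ψ = 0, π`, nor a great circle, `ψ = π / 2`). -/
structure IsRationalHelixOn (I : Set ℝ) (r T : ℝ → Space3) : Prop where
  rational_curve : IsRationalVecOn I r
  rational_tangent : IsRationalVecOn I T
  tangent : IsUnitTangentOn I r T
  constant_angle : ∃ (u : Space3) (ψ : ℝ), ‖u‖ = 1 ∧ 0 < ψ ∧ ψ < Real.pi ∧ ψ ≠ Real.pi / 2 ∧
    ∀ t ∈ I, inner ℝ (T t) u = Real.cos ψ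

/-- `(f 0, f 1, f 2)` is on `I` a rational rotation-minimizing frame of `r`: a rational orthonormal
frame, adapted (`f 0` is a unit tangent), with `f₁' · f₂ = 0`. -/
structure IsRRMFOn (I : Set ℝ) (r : ℝ → Space3) (f : Fin 3 → ℝ → Space3) : Prop where
  rational : ∀ k, IsRationalVecOn I (f k)
  orthonormal : ∀ t ∈ I, Orthonormal ℝ (fun k => f k t)
  adapted : IsUnitTangentOn I r (f 0)
  rotation_minimizing : ∀ t ∈ I, inner ℝ (deriv (f 1) t) (f 2 t) = 0

open Polynomial

/-! Write `c = cos ψ`. In a rotation-minimizing frame, `g₁ = f₁ · u` and `g₂ = f₂ · u` satisfy `g₁²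
+ g₂² = 1 - c²`, and the point `(g₁, g₂)` turns at the rate `±c |T'| / √(1 - c²)`
(`wronskian_inner_sq_eq`). A tangent of degree 2 runs through its circle in the standard way, `|T'|
= 2b √(1 - c²) / ((t - a)² + b²)` for `b > 0` (`exists_norm_deriv_sq_eq`). So `g₁ + i g₂` is, up to
a constant factor, the power `±c` of `(t - z) / (t - z̄)` with `z = a + bi`. A rational function has
integer orders at `z`, which forces `c` to be an integer (`exists_int_eq_of_wronskian`), whereas `0
< |c| < 1`. -/

/-! ### Residues of logarithmic derivatives -/

/-- The hypothesis is `P'/P - R'/R = κ / ((X - z)(X - w))` with denominators cleared; for `z ≠ w`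
the conclusion compares residues at `z`. -/
theorem logDeriv_residue (P R : ℂ[X]) (hP : P ≠ 0) (hR : R ≠ 0) (z w κ : ℂ)
    (h : (derivative P * R - P * derivative R) * ((X - C z) * (X - C w)) = C κ * (P * R)) :
    ((P.rootMultiplicity z : ℂ) - R.rootMultiplicity z) * (z - w) = κ := by
  obtain ⟨P₁, hP₁, hPz⟩ := exists_eq_pow_rootMultiplicity_mul_and_not_dvd P hP z
  obtain ⟨R₁, hR₁, hRz⟩ := exists_eq_pow_rootMultiplicity_mul_and_not_dvd R hR z
  generalize rootMultiplicity z P = m at *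
  generalize rootMultiplicity z R = n at *
  rw [dvd_iff_isRoot, IsRoot.def] at hPz hRz
  -- The extra factor `X - z` avoids the exponent `k - 1`, so `k = 0` needs no separate treatment
  -- later.
  have hd : ∀ (k : ℕ) (S : ℂ[X]), derivative ((X - C z) ^ k * S) * (X - C z) =
      (X - C z) ^ k * (C (k : ℂ) * S + (X - C z) * derivative S) := by
    intro k S
    cases k with
    | zero => simp; ring
    | succ k => simp [derivative_pow]; ring
  have e : (X - C z) ^ (m + n) * ((C (m : ℂ) * P₁ + (X - C z) * derivative P₁) * R₁ * (X - C w)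
      - P₁ * (C (n : ℂ) * R₁ + (X - C z) * derivative R₁) * (X - C w)) =
      (X - C z) ^ (m + n) * (C κ * (P₁ * R₁)) := by
    have h1 := hd m P₁
    have h2 := hd n R₁
    rw [← hP₁] at h1
    rw [← hR₁] at h2
    calc _ = ((X - C z) ^ m * (C (m : ℂ) * P₁ + (X - C z) * derivative P₁)) * ((X - C z) ^ n * R₁) *
          (X - C w) - ((X - C z) ^ m * P₁) *
            ((X - C z) ^ n * (C (n : ℂ) * R₁ + (X - C z) * derivative R₁)) * (X - C w) := by ring
      _ = (derivative P * R - P * derivative R) * ((X - C z) * (X - C w)) := by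
          rw [← h1, ← h2, ← hP₁, ← hR₁]; ring
      _ = _ := by rw [h]; nth_rewrite 1 [hP₁, hR₁]; ring
  have e2 := mul_left_cancel₀ (pow_ne_zero _ (X_sub_C_ne_zero z)) e
  have e3 := congrArg (eval z) e2
  simp only [eval_sub, eval_mul, eval_add, eval_C, eval_X, sub_self, zero_mul, add_zero] at e3
  have : eval z P₁ * eval z R₁ ≠ 0 := mul_ne_zero hPz hRz
  apply mul_left_cancel₀ this
  linear_combination e3

/-- Apply the residue identity to `P = A + iB` and `R = A - iB`, for which `P'R - PR' = 2i(AB' -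
A'B)`. It yields `m - n = 2c` for their multiplicities at `a + bi`. -/
theorem exists_int_eq_of_wronskian (A B Q : ℝ[X]) (a b s c : ℝ) (hb : b ≠ 0) (hs : s ≠ 0)
    (hQ : Q ≠ 0) (hAB : A ^ 2 + B ^ 2 = C s * Q ^ 2)
    (h : (A * derivative B - derivative A * B) * ((X - C a) ^ 2 + C b ^ 2) =
      C (2 * b * c) * (A ^ 2 + B ^ 2)) : ∃ n : ℤ, c = n := by
  set φ : ℝ[X] →+* ℂ[X] := mapRingHom (algebraMap ℝ ℂ) with hφ
  have hφd : ∀ S, φ (derivative S) = derivative (φ S) := fun S => (derivative_map S _).symm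
  have hφC : ∀ x : ℝ, φ (C x) = C (x : ℂ) := fun x => by simp [hφ]
  have hφX : φ X = X := by simp [hφ]
  have hI : (C Complex.I : ℂ[X]) ^ 2 = -1 := by rw [← C_pow, Complex.I_sq]; simp
  have hQ' : φ Q ≠ 0 := by
    simpa [hφ] using (Polynomial.map_ne_zero (f := algebraMap ℝ ℂ) hQ)
  have e1 := congrArg φ hAB
  have e2 := congrArg φ h
  simp only [map_mul, map_add, map_sub, map_pow, hφd, hφC, hφX] at e1 e2
  have hs' : (C (s : ℂ) : ℂ[X]) ≠ 0 := by simpa using hs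
  have hprod : (φ A + C Complex.I * φ B) * (φ A - C Complex.I * φ B) = C (s : ℂ) * φ Q ^ 2 := by
    rw [← e1]; linear_combination (-(φ B) ^ 2) * hI
  have hne := mul_ne_zero hs' (pow_ne_zero 2 hQ')
  rw [← hprod] at hne
  have key := logDeriv_residue _ _ (left_ne_zero_of_mul hne) (right_ne_zero_of_mul hne)
    (a + b * Complex.I) (a - b * Complex.I) (4 * b * c * Complex.I) (by
      simp only [derivative_add, derivative_sub, derivative_mul, derivative_C, C_add, C_sub, C_mul,
        zero_mul, zero_add, map_ofNat, Complex.ofReal_ofNat] at e2 ⊢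
      linear_combination (2 * C Complex.I) * e2 +
        (4 * C (b : ℂ) * C (c : ℂ) * C Complex.I * φ B ^ 2 - 2 * C Complex.I * C (b : ℂ) ^ 2 *
          (φ A * derivative (φ B) - derivative (φ A) * φ B)) * hI)
  -- As `PR = s Q²`, the sum `m + n` is even; this parity makes `c`, not merely `2c`, an integer.
  have hm := congrArg (rootMultiplicity (a + b * Complex.I)) hprod
  rw [rootMultiplicity_mul hne, rootMultiplicity_mul (mul_ne_zero hs' (pow_ne_zero 2 hQ')),
    rootMultiplicity_C, pow_two, rootMultiplicity_mul (mul_ne_zero hQ' hQ'), zero_add] at hm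
  generalize rootMultiplicity _ (φ A + _) = m at *
  generalize rootMultiplicity _ (φ A - _) = n at *
  generalize rootMultiplicity _ (φ Q) = k at *
  refine ⟨m - k, ?_⟩
  have hm' : (n : ℂ) = 2 * k - m := by
    have : (m : ℂ) + n = k + k := by exact_mod_cast hm
    linear_combination this
  rw [hm'] at key
  have hbI : (4 * b * Complex.I : ℂ) ≠ 0 := by simp [hb]
  have : (c : ℂ) = m - k := by
    apply mul_left_cancel₀ hbI
    linear_combination -key
  exact_mod_cast this

/-! ### Unit tangents of degree two -/

theorem Orthonormal.real_inner_eq_sum {e : Fin 3 → Space3} (he : Orthonormal ℝ e) (x y : Space3) :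
    inner ℝ x y = ∑ i, inner ℝ x (e i) * inner ℝ y (e i) := by
  have hc : Fintype.card (Fin 3) = Module.finrank ℝ Space3 := by simp
  have hb := coe_basisOfOrthonormalOfCardEqFinrank he hc
  set b := basisOfOrthonormalOfCardEqFinrank he hc
  have hob : Orthonormal ℝ b := hb ▸ he
  rw [← (b.toOrthonormalBasis hob).sum_inner_mul_inner x y]
  simp [hb, real_inner_comm]

theorem coeff_eq_zero_of_infinite {S : Set ℝ} (hS : S.Infinite) (a : ℝ) (k : Fin 5 → ℝ)
    (h : ∀ t ∈ S, ∑ i, k i * (t - a) ^ (i : ℕ) = 0) : k = 0 := by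
  set p : ℝ[X] := ∑ i : Fin 5, C (k i) * X ^ (i : ℕ) with hp
  have hp0 : p = 0 := by
    refine eq_zero_of_infinite_isRoot p
      ((hS.image (f := fun t => t - a) sub_left_injective.injOn).mono ?_)
    rintro _ ⟨t, ht, rfl⟩
    simpa [hp, eval_finsetSum, IsRoot.def] using h t ht
  funext i
  have := congrArg (fun f => coeff f i) hp0
  simpa [hp, finsetSum_coeff, coeff_C_mul, coeff_X_pow, Fin.val_inj] using this

/-- Squares of real leading coefficients cannot cancel. -/
theorem natDegree_le_of_sum_sq_eq_sq {p : Fin 3 → ℝ[X]} {q : ℝ[X]} (h : ∑ i, p i ^ 2 = q ^ 2)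
    (i : Fin 3) : (p i).natDegree ≤ q.natDegree := by
  by_contra! hi
  obtain ⟨j, -, hj⟩ := Finset.exists_max_image Finset.univ (fun i => (p i).natDegree) ⟨i, by simp⟩
  set d := (p j).natDegree with hd
  have hqd : q.natDegree < d := hi.trans_le (hj i (by simp))
  have e := congrArg (fun f => coeff f (d * 2)) h
  simp only [finsetSum_coeff, mul_comm d 2] at e
  have hq0 : coeff (q ^ 2) (2 * d) = 0 :=
    coeff_eq_zero_of_natDegree_lt (natDegree_pow_le.trans_lt (by omega))
  have hpc : ∀ i, coeff (p i ^ 2) (2 * d) = coeff (p i) d ^ 2 := fun i =>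
    coeff_pow_of_natDegree_le (hj i (by simp))
  rw [hq0, Finset.sum_congr rfl fun i _ => hpc i] at e
  have := (Finset.sum_eq_zero_iff_of_nonneg fun i _ => sq_nonneg (coeff (p i) d)).1 e j (by simp)
  have h0 : p j = 0 := by
    rw [← leadingCoeff_eq_zero, leadingCoeff, ← hd]; simpa using this
  simp [h0] at hd
  omega

/-- From `∑ pᵢ² = q²`, a real root of `q` would be common to all `pᵢ`. Hence `q` is a quadratic
without real roots; complete its square and divide. -/
theorem exists_quadratic_form {I : Set ℝ} (hI : I.Infinite) {T : ℝ → Space3}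
    (hT : ∀ t ∈ I, ‖T t‖ = 1) (hdeg : HasRationalDegreeOn I T 2) :
    ∃ (a b : ℝ) (v₀ v₁ v₂ : Space3), 0 < b ∧ (v₁ ≠ 0 ∨ v₂ ≠ 0) ∧
      ∀ t ∈ I, T t = v₀ + ((t - a) ^ 2 + b ^ 2)⁻¹ • ((t - a) • v₁ + v₂) := by
  obtain ⟨p, q, hcop, hd, hpq⟩ := hdeg
  have hsum : ∑ i, p i ^ 2 = q ^ 2 := by
    refine eq_of_infinite_eval_eq _ _ (hI.mono fun t ht => ?_)
    obtain ⟨hq, hv⟩ := hpq t ht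
    have h1 := EuclideanSpace.real_norm_sq_eq (T t)
    simp only [hT t ht, hv, div_pow, ← Finset.sum_div] at h1
    field_simp at h1
    simpa [eval_finsetSum] using h1.symm
  have hroot : ∀ x, q.eval x ≠ 0 := by
    intro x hx
    have e := congrArg (eval x) hsum
    simp only [eval_finsetSum, eval_pow, hx] at e
    rw [zero_pow two_ne_zero, Finset.sum_eq_zero_iff_of_nonneg fun i _ => sq_nonneg _] at e
    refine not_isUnit_X_sub_C x (hcop _ (dvd_iff_isRoot.2 hx) fun i => dvd_iff_isRoot.2 ?_)
    simpa using e i (by simp)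
  have hle := natDegree_le_of_sum_sq_eq_sq hsum
  have hqd : q.natDegree = 2 := by
    rwa [max_eq_left (Finset.sup_le fun i _ => hle i)] at hd
  have hev : ∀ r : ℝ[X], r.natDegree ≤ 2 → ∀ t, r.eval t =
      r.coeff 0 + r.coeff 1 * t + r.coeff 2 * t ^ 2 := by
    intro r hr t
    rw [eval_eq_sum_range' (n := 3) (by omega)]
    simp [Finset.sum_range_succ]
  have hk : q.coeff 2 ≠ 0 := by
    rw [← hqd]; simpa using fun h : q = 0 => by simp [h] at hqd
  set k := q.coeff 2
  set a := -q.coeff 1 / (2 * k) with ha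
  have hq : ∀ t, q.eval t = k * ((t - a) ^ 2 + (q.coeff 0 / k - a ^ 2)) := by
    intro t
    rw [hev q hqd.le, ha]
    field_simp
    ring
  have hpos : 0 < q.coeff 0 / k - a ^ 2 := by
    by_contra! hneg
    apply hroot (a + √(-(q.coeff 0 / k - a ^ 2)))
    rw [hq, add_sub_cancel_left, Real.sq_sqrt (by linarith)]
    ring
  set b := √(q.coeff 0 / k - a ^ 2) with hb
  have hb2 : q.coeff 0 / k - a ^ 2 = b ^ 2 := (Real.sq_sqrt hpos.le).symm
  rw [hb2] at hq
  have hb0 : 0 < b := Real.sqrt_pos.2 hpos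
  have hp : ∀ i t, (p i).eval t = k * ((p i).coeff 2 / k * ((t - a) ^ 2 + b ^ 2) +
      ((t - a) * ((2 * (p i).coeff 2 * a + (p i).coeff 1) / k) +
      ((p i).coeff 2 * (a ^ 2 - b ^ 2) + (p i).coeff 1 * a + (p i).coeff 0) / k)) := by
    intro i t
    rw [hev (p i) (hqd ▸ hle i)]
    field_simp
    ring
  refine ⟨a, b, WithLp.toLp 2 fun i => (p i).coeff 2 / k,
    WithLp.toLp 2 fun i => (2 * (p i).coeff 2 * a + (p i).coeff 1) / k,
    WithLp.toLp 2 fun i => ((p i).coeff 2 * (a ^ 2 - b ^ 2) + (p i).coeff 1 * a + (p i).coeff 0) / k,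
    hb0, ?_, fun t ht => ?_⟩
  -- If both vectors vanished, `q` would divide every `pᵢ`, against lowest terms.
  · by_contra! h
    have hunit : IsUnit q := by
      refine hcop q dvd_rfl fun i => ⟨C ((p i).coeff 2 / k), Polynomial.funext fun t => ?_⟩
      have h1 : (2 * (p i).coeff 2 * a + (p i).coeff 1) / k = 0 := congrArg (fun v : Space3 => v i) h.1
      have h2 : ((p i).coeff 2 * (a ^ 2 - b ^ 2) + (p i).coeff 1 * a + (p i).coeff 0) / k = 0 :=
        congrArg (fun v : Space3 => v i) h.2
      rw [hp, h1, h2, eval_mul, hq, eval_C]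
      ring
    rw [natDegree_eq_zero_of_isUnit hunit] at hqd
    omega
  · ext i
    have hD : (t - a) ^ 2 + b ^ 2 ≠ 0 := by positivity
    rw [(hpq t ht).2 i, hp, hq]
    simp only [PiLp.add_apply, PiLp.smul_apply, smul_eq_mul]
    field_simp

/-- The constraints make `v₁`, `v₂`, `u` mutually orthogonal with `|v₂| = b |v₁|`, whence `|T'| =
|v₁| / ((t - a)² + b²)`. Expanding the unit vector `v₀` in the resulting basis gives `|v₁|`. -/
theorem exists_norm_deriv_sq_eq {I : Set ℝ} (hI : IsOpen I) (hne : I.Nonempty) {T : ℝ → Space3}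
    (hT : ∀ t ∈ I, ‖T t‖ = 1) (hdeg : HasRationalDegreeOn I T 2) {u : Space3} (hu : ‖u‖ = 1)
    {c : ℝ} (hc : ∀ t ∈ I, inner ℝ (T t) u = c) :
    ∃ a b : ℝ, b ≠ 0 ∧ ∀ t ∈ I, ∃ T', HasDerivAt T T' t ∧
      ‖T'‖ ^ 2 * ((t - a) ^ 2 + b ^ 2) ^ 2 = 4 * b ^ 2 * (1 - c ^ 2) := by
  have hinf : I.Infinite := by
    obtain ⟨x, hx⟩ := hne
    exact infinite_of_mem_nhds x (hI.mem_nhds hx)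
  obtain ⟨a, b, v₀, v₁, v₂, hb, hv, hTf⟩ := exists_quadratic_form hinf hT hdeg
  have hD : ∀ t, (t - a) ^ 2 + b ^ 2 ≠ 0 := fun t => by positivity
  have hDT : ∀ t ∈ I, ((t - a) ^ 2 + b ^ 2) • T t =
      ((t - a) ^ 2 + b ^ 2) • v₀ + ((t - a) • v₁ + v₂) := by
    intro t ht
    rw [hTf t ht, smul_add, smul_inv_smul₀ (hD t)]
  -- With `D = (t - a)² + b²`, these are the coefficients of `|D T|² - D²` in powers of `t - a`;
  -- those of `D T · u - c D` follow.
  have hnorm := coeff_eq_zero_of_infinite hinf a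
    ![b ^ 4 * inner ℝ v₀ v₀ + 2 * b ^ 2 * inner ℝ v₀ v₂ + inner ℝ v₂ v₂ - b ^ 4,
      2 * b ^ 2 * inner ℝ v₀ v₁ + 2 * inner ℝ v₁ v₂,
      2 * b ^ 2 * inner ℝ v₀ v₀ + 2 * inner ℝ v₀ v₂ + inner ℝ v₁ v₁ - 2 * b ^ 2,
      2 * inner ℝ v₀ v₁, inner ℝ v₀ v₀ - 1] (by
    intro t ht
    have e := congrArg (fun v => inner ℝ v v) (hDT t ht)
    simp only [inner_add_left, inner_add_right, real_inner_smul_left, real_inner_smul_right,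
      real_inner_self_eq_norm_sq (T t), hT t ht, real_inner_comm v₀, real_inner_comm v₁ v₂] at e
    simp only [Fin.sum_univ_five, Matrix.cons_val]
    norm_num
    simp only [real_inner_self_eq_norm_sq] at e
    linear_combination -e)
  have hang := coeff_eq_zero_of_infinite hinf a
    ![b ^ 2 * inner ℝ v₀ u + inner ℝ v₂ u - b ^ 2 * c, inner ℝ v₁ u, inner ℝ v₀ u - c, 0, 0] (by
    intro t ht
    have e := congrArg (fun v => inner ℝ v u) (hDT t ht)
    simp only [inner_add_left, real_inner_smul_left, hc t ht] at e
    simp [Fin.sum_univ_five]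
    linear_combination -e)
  have n0 := congrFun hnorm 0
  have n1 := congrFun hnorm 1
  have n2 := congrFun hnorm 2
  have n3 := congrFun hnorm 3
  have n4 := congrFun hnorm 4
  have a0 := congrFun hang 0
  have a1 := congrFun hang 1
  have a2 := congrFun hang 2
  simp only [Matrix.cons_val, Pi.zero_apply] at n0 n1 n2 n3 n4 a0 a1 a2
  have i00 : inner ℝ v₀ v₀ = 1 := by linear_combination n4
  have i01 : inner ℝ v₀ v₁ = 0 := by linear_combination n3 / 2
  have i12 : inner ℝ v₁ v₂ = 0 := by linear_combination n1 / 2 - b ^ 2 * i01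
  have i02 : inner ℝ v₀ v₂ = -inner ℝ v₁ v₁ / 2 := by linear_combination n2 / 2 - b ^ 2 * i00
  have i22 : inner ℝ v₂ v₂ = b ^ 2 * inner ℝ v₁ v₁ := by
    linear_combination n0 - b ^ 4 * i00 - 2 * b ^ 2 * i02
  have i0u : inner ℝ v₀ u = c := by linear_combination a2
  have i2u : inner ℝ v₂ u = 0 := by linear_combination a0 - b ^ 2 * a2
  have hm : inner ℝ v₁ v₁ ≠ 0 := by
    intro h
    rw [h, mul_zero] at i22
    rcases hv with hv | hv
    · exact hv (inner_self_eq_zero.1 h)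
    · exact hv (inner_self_eq_zero.1 i22)
  have hmn : ‖v₁‖ ≠ 0 := by rw [real_inner_self_eq_norm_sq] at hm; exact fun h => hm (by simp [h])
  have hn2 : ‖v₂‖ = b * ‖v₁‖ := by
    rw [← sq_eq_sq₀ (by positivity) (by positivity), mul_pow, ← real_inner_self_eq_norm_sq, i22,
      real_inner_self_eq_norm_sq]
  have hon : Orthonormal ℝ ![u, ‖v₁‖⁻¹ • v₁, ‖v₂‖⁻¹ • v₂] := by
    constructor
    · intro i
      fin_cases i
      · simpa using hu
      · simp [norm_smul, hmn]
      · simp only [Fin.reduceFinMk, Matrix.cons_val, norm_smul, norm_inv, norm_norm]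
        exact inv_mul_cancel₀ (hn2 ▸ mul_ne_zero hb.ne' hmn)
    · intro i j hij
      fin_cases i <;> fin_cases j <;>
        simp_all [real_inner_smul_right, real_inner_comm]
  have hv1 : ‖v₁‖ ^ 2 = 4 * b ^ 2 * (1 - c ^ 2) := by
    have e := hon.real_inner_eq_sum v₀ v₀
    simp only [Fin.sum_univ_three, Matrix.cons_val, real_inner_smul_right, i00, i0u, i01, i02, hn2,
      real_inner_self_eq_norm_sq] at e
    field_simp at e
    refine mul_left_cancel₀ (pow_ne_zero 2 hmn) ?_
    linear_combination -e
  refine ⟨a, b, hb.ne', fun t ht => ?_⟩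
  have h1 : HasDerivAt (fun t : ℝ => t - a) 1 t := (hasDerivAt_id t).sub_const a
  have hder := (((h1.pow 2).add_const (b ^ 2)).inv (hD t)).smul ((h1.smul_const v₁).add_const v₂)
  have hder' := (hder.const_add v₀).congr_of_eventuallyEq (f₁ := T)
    (Filter.eventuallyEq_of_mem (hI.mem_nhds ht) fun s hs => by simpa using hTf s hs)
  refine ⟨_, hder', ?_⟩
  rw [← hv1, ← real_inner_self_eq_norm_sq, ← real_inner_self_eq_norm_sq]
  simp only [inner_add_left, inner_add_right, real_inner_smul_left, real_inner_smul_right,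
    real_inner_comm v₁ v₂, i12, i22]
  have := hD t
  simp
  field_simp
  ring

/-! ### Rational functions on a set -/

theorem IsRationalOn.add {I : Set ℝ} {f g : ℝ → ℝ} (hf : IsRationalOn I f)
    (hg : IsRationalOn I g) : IsRationalOn I (fun t => f t + g t) := by
  obtain ⟨p, q, h⟩ := hf
  obtain ⟨p', q', h'⟩ := hg
  refine ⟨p * q' + q * p', q * q', fun t ht => ?_⟩
  obtain ⟨hq, e⟩ := h t ht
  obtain ⟨hq', e'⟩ := h' t ht
  simp [hq, hq', e, e', div_add_div]

theorem IsRationalOn.mul_const {I : Set ℝ} {f : ℝ → ℝ} (hf : IsRationalOn I f) (c : ℝ) :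
    IsRationalOn I (fun t => f t * c) := by
  obtain ⟨p, q, h⟩ := hf
  refine ⟨p * C c, q, fun t ht => ⟨(h t ht).1, ?_⟩⟩
  simp only [(h t ht).2, eval_mul, eval_C]
  ring

theorem IsRationalVecOn.inner_const {I : Set ℝ} {v : ℝ → Space3} (hv : IsRationalVecOn I v)
    (u : Space3) : IsRationalOn I (fun t => inner ℝ (v t) u) := by
  have := (((hv 0).mul_const (u 0)).add ((hv 1).mul_const (u 1))).add ((hv 2).mul_const (u 2))
  convert this using 2 with t
  simp [PiLp.inner_apply, Fin.sum_univ_three, mul_comm]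

theorem IsRationalOn.exists_common_denominator {I : Set ℝ} {f g : ℝ → ℝ} (hf : IsRationalOn I f)
    (hg : IsRationalOn I g) : ∃ A B Q : ℝ[X], ∀ t ∈ I, Q.eval t ≠ 0 ∧
      f t = A.eval t / Q.eval t ∧ g t = B.eval t / Q.eval t := by
  obtain ⟨p, q, h⟩ := hf
  obtain ⟨p', q', h'⟩ := hg
  refine ⟨p * q', p' * q, q * q', fun t ht => ?_⟩
  obtain ⟨hq, e⟩ := h t ht
  obtain ⟨hq', e'⟩ := h' t ht
  refine ⟨by simp [hq, hq'], ?_, ?_⟩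
  · rw [e, eval_mul, eval_mul, mul_div_mul_right _ _ hq']
  · rw [e', eval_mul, eval_mul, mul_comm (eval t q), mul_div_mul_right _ _ hq]

theorem IsRationalOn.differentiableAt {I : Set ℝ} (hI : IsOpen I) {f : ℝ → ℝ}
    (hf : IsRationalOn I f) {t : ℝ} (ht : t ∈ I) : DifferentiableAt ℝ f t := by
  obtain ⟨p, q, h⟩ := hf
  exact (p.differentiableAt.div q.differentiableAt (h t ht).1).congr_of_eventuallyEq
    (Filter.eventuallyEq_of_mem (hI.mem_nhds ht) fun s hs => (h s hs).2)

theorem IsRationalVecOn.differentiableAt {I : Set ℝ} (hI : IsOpen I) {v : ℝ → Space3}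
    (hv : IsRationalVecOn I v) {t : ℝ} (ht : t ∈ I) : DifferentiableAt ℝ v t :=
  differentiableAt_euclidean.2 fun i => (hv i).differentiableAt hI ht

/-! ### Unit tangents and rotation-minimizing frames -/

/-- Near a point with `σ ≠ 0`, the ratio `σ / ρ` is continuous with values `±1`, so it is locally
constant. A small open set suffices, since polynomial identities need only infinitely many points.
-/
theorem IsUnitTangentOn.eq_or_neg_on_open {I : Set ℝ} (hI : IsOpen I) {r T S : ℝ → Space3}
    (hT : IsUnitTangentOn I r T) (hS : IsUnitTangentOn I r S) :
    ∃ J ⊆ I, IsOpen J ∧ J.Nonempty ∧ ∃ ε : ℝ, ε ^ 2 = 1 ∧ ∀ t ∈ J, S t = ε • T t := by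
  obtain ⟨hT1, σ, hσ, ⟨t₀, ht₀, hσ₀⟩, hrT⟩ := hT
  obtain ⟨hS1, ρ, hρ, -, hrS⟩ := hS
  have heq : ∀ t ∈ I, σ t • T t = ρ t • S t := fun t ht => (hrT t ht).unique (hrS t ht)
  have habs : ∀ t ∈ I, σ t ^ 2 = ρ t ^ 2 := by
    intro t ht
    have := congrArg norm (heq t ht)
    simpa [norm_smul, hT1 t ht, hS1 t ht, ← sq_eq_sq_iff_abs_eq_abs] using this
  have hσ₂ : σ t₀ ^ 2 ≠ 0 := pow_ne_zero 2 hσ₀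
  have hρ₀ : ρ t₀ ≠ 0 := fun h => hσ₂ (by rw [habs t₀ ht₀, h]; simp)
  have hσc := (hσ.differentiableAt hI ht₀).continuousAt
  have hρc := (hρ.differentiableAt hI ht₀).continuousAt
  have hpos : 0 < σ t₀ / ρ t₀ * (σ t₀ / ρ t₀) := mul_self_pos.2 (div_ne_zero hσ₀ hρ₀)
  have hev := ((hρc.eventually_ne hρ₀).and
    (((hσc.div hρc hρ₀).mul_const (σ t₀ / ρ t₀)).eventually_const_lt hpos)).and (hI.mem_nhds ht₀)
  obtain ⟨J, hJ, hJo, hJ₀⟩ := eventually_nhds_iff.1 hev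
  have hsq : ∀ t ∈ I, ρ t ≠ 0 → (σ t / ρ t) ^ 2 = 1 := fun t ht h => by
    rw [div_pow, habs t ht, div_self (pow_ne_zero 2 h)]
  refine ⟨J, fun t ht => (hJ t ht).2, hJo, ⟨t₀, hJ₀⟩, σ t₀ / ρ t₀, hsq t₀ ht₀ hρ₀, fun t ht => ?_⟩
  obtain ⟨⟨hρt, hlt⟩, htI⟩ := hJ t ht
  have hlt' : 0 < σ t / ρ t * (σ t₀ / ρ t₀) := hlt
  have : σ t / ρ t = σ t₀ / ρ t₀ := by
    rcases sq_eq_sq_iff_eq_or_eq_neg.1 ((hsq t htI hρt).trans (hsq t₀ ht₀ hρ₀).symm) with h | h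
    · exact h
    · rw [h] at hlt'
      linarith
  rw [← this, div_eq_inv_mul, mul_smul, heq t htI, inv_smul_smul₀ hρt]

/-- With `yᵢ = f₀' · fᵢ`, rotation minimization leaves `fᵢ' = -yᵢ f₀`, so `gᵢ' = -c yᵢ` for `gᵢ = fᵢ
· u`. Since `f₀' · u = 0`, also `y₁ g₁ + y₂ g₂ = 0`, and Lagrange's identity gives the square of `y₁
g₂ - y₂ g₁`. -/
theorem wronskian_inner_sq_eq {J : Set ℝ} (hJ : IsOpen J) {f : Fin 3 → ℝ → Space3}
    (hd : ∀ k, ∀ t ∈ J, DifferentiableAt ℝ (f k) t)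
    (hon : ∀ t ∈ J, Orthonormal ℝ (fun k => f k t))
    (hrm : ∀ t ∈ J, inner ℝ (deriv (f 1) t) (f 2 t) = 0) {u : Space3} (hu : ‖u‖ = 1) {c : ℝ}
    (hc : ∀ t ∈ J, inner ℝ (f 0 t) u = c) {t : ℝ} (ht : t ∈ J) :
    inner ℝ (f 1 t) u ^ 2 + inner ℝ (f 2 t) u ^ 2 = 1 - c ^ 2 ∧
    (inner ℝ (f 1 t) u * inner ℝ (deriv (f 2) t) u -
      inner ℝ (deriv (f 1) t) u * inner ℝ (f 2 t) u) ^ 2 =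
      (1 - c ^ 2) * (c ^ 2 * ‖deriv (f 0) t‖ ^ 2) := by
  have hskew : ∀ i j, inner ℝ (f i t) (deriv (f j) t) + inner ℝ (deriv (f i) t) (f j t) = 0 := by
    intro i j
    refine ((hd i t ht).hasDerivAt.inner ℝ (hd j t ht).hasDerivAt).unique ?_
    refine (hasDerivAt_const t (if i = j then (1 : ℝ) else 0)).congr_of_eventuallyEq
      (Filter.eventuallyEq_of_mem (hJ.mem_nhds ht) fun s hs => ?_)
    exact orthonormal_iff_ite.1 (hon s hs) i j
  have h0u : inner ℝ (deriv (f 0) t) u = 0 := by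
    have h := (hd 0 t ht).hasDerivAt.inner ℝ (hasDerivAt_const t u)
    simp only [inner_zero_right, zero_add] at h
    exact h.unique ((hasDerivAt_const t c).congr_of_eventuallyEq
      (Filter.eventuallyEq_of_mem (hJ.mem_nhds ht) hc))
  have hP := (hon t ht).real_inner_eq_sum
  have s00 := hskew 0 0
  have s01 := hskew 0 1
  have s02 := hskew 0 2
  have s11 := hskew 1 1
  have s12 := hskew 1 2
  have s22 := hskew 2 2
  have hr := hrm t ht
  have hct := hc t ht
  have e0 := hP (deriv (f 0) t) u
  have e1 := hP (deriv (f 1) t) u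
  have e2 := hP (deriv (f 2) t) u
  have e3 := hP u u
  have e4 := hP (deriv (f 0) t) (deriv (f 0) t)
  rw [real_inner_self_eq_norm_sq] at e3 e4
  simp only [Fin.sum_univ_three, real_inner_comm _ u, hu, h0u, hct] at e0 e1 e2 e3 e4
  simp only [real_inner_comm (deriv (f _) t) (f _ t)] at s00 s01 s02 s11 s12 s22
  have x00 : inner ℝ (deriv (f 0) t) (f 0 t) = 0 := by linarith
  have x11 : inner ℝ (deriv (f 1) t) (f 1 t) = 0 := by linarith
  have x22 : inner ℝ (deriv (f 2) t) (f 2 t) = 0 := by linarith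
  have x21 : inner ℝ (deriv (f 2) t) (f 1 t) = 0 := by linarith
  have x10 : inner ℝ (deriv (f 1) t) (f 0 t) = -inner ℝ (deriv (f 0) t) (f 1 t) := by linarith
  have x20 : inner ℝ (deriv (f 2) t) (f 0 t) = -inner ℝ (deriv (f 0) t) (f 2 t) := by linarith
  rw [x00] at e0 e4
  rw [x10, x11, hr] at e1
  rw [x20, x21, x22] at e2
  rw [e1, e2, e4]
  generalize inner ℝ (f 1 t) u = g₁ at *
  generalize inner ℝ (f 2 t) u = g₂ at *
  generalize inner ℝ (deriv (f 0) t) (f 1 t) = y₁ at *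
  generalize inner ℝ (deriv (f 0) t) (f 2 t) = y₂ at *
  have e5 : g₁ ^ 2 + g₂ ^ 2 = 1 - c ^ 2 := by linear_combination -e3
  refine ⟨e5, ?_⟩
  rw [← e5]
  linear_combination (c ^ 2 * (y₁ * g₁ + y₂ * g₂)) * e0

theorem HasDerivAt.wronskian_div {g₁ g₂ : ℝ → ℝ} {g₁' g₂' t : ℝ} {A B Q : ℝ[X]}
    (h₁ : HasDerivAt g₁ g₁' t) (h₂ : HasDerivAt g₂ g₂' t)
    (h : ∀ᶠ s in nhds t, Q.eval s ≠ 0 ∧ g₁ s = A.eval s / Q.eval s ∧ g₂ s = B.eval s / Q.eval s) :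
    (g₁ t * g₂' - g₁' * g₂ t) * Q.eval t ^ 2 =
      (A * derivative B - derivative A * B).eval t := by
  obtain ⟨hq, e₁, e₂⟩ := h.self_of_nhds
  have d₁ := h₁.unique (((A.hasDerivAt t).div (Q.hasDerivAt t) hq).congr_of_eventuallyEq
    (h.mono fun s hs => hs.2.1))
  have d₂ := h₂.unique (((B.hasDerivAt t).div (Q.hasDerivAt t) hq).congr_of_eventuallyEq
    (h.mono fun s hs => hs.2.2))
  rw [e₁, e₂, d₁, d₂]
  simp only [eval_sub, eval_mul]
  field_simp
  ring

/-! ### The contradiction -/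

theorem mainTheorem4 (I : Set ℝ) (hI : IsOpen I) (hne : I.Nonempty) (r T : ℝ → Space3)
    (hr : IsRationalHelixOn I r T) (hdeg : HasRationalDegreeOn I T 2) :
    ¬ ∃ f : Fin 3 → ℝ → Space3, IsRRMFOn I r f := by
  rintro ⟨f, hf⟩
  obtain ⟨u, ψ, hu, hψ0, hψπ, hψ2, hang⟩ := hr.constant_angle
  set c := Real.cos ψ with hcdef
  have hs : 1 - c ^ 2 ≠ 0 := by
    rw [hcdef, ← Real.sin_sq]
    exact pow_ne_zero 2 (Real.sin_pos_of_pos_of_lt_pi hψ0 hψπ).ne'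
  have hc0 : c ≠ 0 := fun h => hψ2 (Real.injOn_cos ⟨hψ0.le, hψπ.le⟩
    ⟨by positivity, by linarith [Real.pi_pos]⟩ (by rw [← hcdef, h, Real.cos_pi_div_two]))
  have hint : ∀ n : ℤ, c ≠ n := by
    intro n hn
    have h1 : c ^ 2 ≤ 1 := Real.cos_sq_le_one ψ
    rw [hn] at h1 hs hc0
    have hn0 : n ≠ 0 := by exact_mod_cast hc0
    have h1' : n ^ 2 ≤ 1 := by exact_mod_cast h1
    have hn2 : n ^ 2 = 1 := le_antisymm h1' (by have := sq_pos_of_ne_zero hn0; omega)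
    exact hs (by rw [sub_eq_zero]; exact_mod_cast hn2.symm)
  obtain ⟨a, b, hb, hT'⟩ := exists_norm_deriv_sq_eq hI hne hr.tangent.1 hdeg hu hang
  obtain ⟨J, hJI, hJ, ⟨t₀, ht₀⟩, ε, hε, hfT⟩ := hr.tangent.eq_or_neg_on_open hI hf.adapted
  have hinf : J.Infinite := infinite_of_mem_nhds t₀ (hJ.mem_nhds ht₀)
  have hd : ∀ k, ∀ t ∈ J, DifferentiableAt ℝ (f k) t := fun k t ht =>
    (hf.rational k).differentiableAt hI (hJI ht)
  have hpt := fun t (ht : t ∈ J) => wronskian_inner_sq_eq hJ hd (fun t ht => hf.orthonormal t (hJI ht))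
    (fun t ht => hf.rotation_minimizing t (hJI ht)) hu (c := ε * c)
    (fun t ht => by rw [hfT t ht, real_inner_smul_left, hang t (hJI ht)]) ht
  have hder : ∀ t ∈ J, ‖deriv (f 0) t‖ ^ 2 * ((t - a) ^ 2 + b ^ 2) ^ 2 =
      4 * b ^ 2 * (1 - c ^ 2) := by
    intro t ht
    obtain ⟨T', h, h'⟩ := hT' t (hJI ht)
    rw [((h.const_smul ε).congr_of_eventuallyEq
      (Filter.eventuallyEq_of_mem (hJ.mem_nhds ht) hfT)).deriv, norm_smul, mul_pow,
      Real.norm_eq_abs, sq_abs, hε, one_mul, h']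
  obtain ⟨A, B, Q, hABQ⟩ := ((hf.rational 1).inner_const u).exists_common_denominator
    ((hf.rational 2).inner_const u)
  have hQ : Q ≠ 0 := fun h => (hABQ t₀ (hJI ht₀)).1 (by simp [h])
  have hAB : A ^ 2 + B ^ 2 = C (1 - c ^ 2) * Q ^ 2 := by
    refine eq_of_infinite_eval_eq _ _ (hinf.mono fun t ht => ?_)
    obtain ⟨hq, e₁, e₂⟩ := hABQ t (hJI ht)
    have e := (hpt t ht).1
    rw [e₁, e₂, mul_pow, hε] at e
    field_simp at e
    simp only [Set.mem_ofPred_eq, eval_add, eval_pow, eval_mul, eval_C]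
    linear_combination e
  -- Pointwise only squares are known. As an identity in the domain `ℝ[X]` it leaves one global
  -- sign, absorbed by `c ↦ -c`.
  have hW : ((A * derivative B - derivative A * B) * ((X - C a) ^ 2 + C b ^ 2)) ^ 2 =
      (C (2 * b * c) * (A ^ 2 + B ^ 2)) ^ 2 := by
    refine eq_of_infinite_eval_eq _ _ (hinf.mono fun t ht => ?_)
    have hg : ∀ k, HasDerivAt (fun t => inner ℝ (f k t) u) (inner ℝ (deriv (f k) t) u) t := by
      intro k
      simpa using (hd k t ht).hasDerivAt.inner ℝ (hasDerivAt_const t u)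
    have w := (hg 1).wronskian_div (hg 2) (Filter.eventually_of_mem (hJ.mem_nhds ht)
      fun s hs => hABQ s (hJI hs))
    have e := (hpt t ht).2
    rw [mul_pow ε, hε, one_mul] at e
    rw [Set.mem_ofPred_eq, hAB, eval_pow, eval_mul, ← w]
    simp only [eval_mul, eval_pow, eval_add, eval_sub, eval_X, eval_C]
    linear_combination (eval t Q ^ 4 * ((t - a) ^ 2 + b ^ 2) ^ 2) * e +
      (eval t Q ^ 4 * (1 - c ^ 2) * c ^ 2) * hder t ht
  rcases sq_eq_sq_iff_eq_or_eq_neg.1 hW with h | h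
  · obtain ⟨n, hn⟩ := exists_int_eq_of_wronskian A B Q a b _ c hb hs hQ hAB h
    exact hint n hn
  · obtain ⟨n, hn⟩ := exists_int_eq_of_wronskian A B Q a b _ (-c) hb hs hQ hAB (by
      rw [h, mul_neg, C_neg, neg_mul])
    exact hint (-n) (by push_cast; linarith)
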